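/- Let $R$ be a Prüfer domain (an integral domain whose localisation at every prime ideal is a valuation ring) of finite Krull dimension, and let $f\colon X\to \operatorname{Spec} R$ be a morphism of schemes of finite type. For every $x\in X$ both $\operatorname{tr.deg}_{\kappa(f(x))}\kappa(x)$ and the codimension of $\overline{\{f(x)\}}$ in $\operatorname{Spec} R$ are finite, and the function $$\delta\colon |X|\to\mathbb Z,\qquad \delta(x)=\operatorname{tr.deg}_{\kappa(f(x))}\kappa(x)-\operatorname{codim}\overline{\{f(x)\}},$$ is a bounded dimension function, that is: 1. if $x$ specialises to $y\neq x$, then $\delta(x)>\delta(y)$; 2. a specialisation $x\rightsquigarrow y$ is immediate (meaning $x\ne y$ and every $z$ with $x\rightsquigarrow z\rightsquigarrow y$ is $x$ or $y$) if and only if $\delta(x)=\delta(y)+1$; 3. there are integers $a,b$ with $a\le\delta(x)\le b$ for all $x\in X$. Moreover, $|X|$ is catenary and of finite Krull dimension, and so is $|\operatorname{Spec} A|$ for every semilocalisation $A$ of $X$ at finitely many points $x_1,\dots,x_n$ of an affine open $U\subseteq X$, i.e. $A$ is the localisation of $\Gamma(U,\mathcal O_X)$ at the complement of the union of the primes corresponding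 to $x_1,\dots,x_n$. Finally, $R$ is universally catenary: every scheme locally of finite type over $\operatorname{Spec} R$ is catenary. Here a topological space is catenary if for all irreducible closed subsets $T\subseteq T'$ the lengths of chains of irreducible closed subsets from $T$ to $T'$ are bounded, a maximal such chain $T=T_0\subsetneq T_1\subsetneq\dots\subsetneq T_n=T'$ exists, and all maximal such chains have the same length. (The empty space counts as being of finite Krull dimension.) -/

import Mathlib

open AlgebraicGeometry CategoryTheory TopologicalSpace

universe u

/-- A Prüfer domain: an integral domain whose localisation at every prime ideal is a
valuation ring. -/
structure IsPruferDomain (R : Type u) [CommRing R] : Prop where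
  isDomain : IsDomain R
  valuationRing_localization : ∀ (p : Ideal R) [p.IsPrime],
    ∃ _ : IsDomain (Localization.AtPrime p), ValuationRing (Localization.AtPrime p)

/-- A chain `T₀ ⊂ T₁ ⊂ ⋯ ⊂ Tₙ` of irreducible closed subsets from `T` to `T'` (so `T₀ = T` and
`Tₙ = T'`) that cannot be refined: there is no irreducible closed subset strictly between two
consecutive members. -/
def IsMaximalChainFromTo {X : Type u} [TopologicalSpace X] (T T' : IrreducibleCloseds X)
    (p : LTSeries (IrreducibleCloseds X)) : Prop :=
  p.head = T ∧ p.last = T' ∧ ∀ i : Fin p.length, p i.castSucc ⋖ p i.succ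

/-- A topological space is catenary if for every pair `T ⊆ T'` of irreducible closed subsets the
lengths of the chains of irreducible closed subsets from `T` to `T'` are bounded (that is, the
codimension of `T` in `T'` is finite), a maximal such chain exists, and all maximal
such chains have the same length. -/
def IsCatenarySpace (X : Type u) [TopologicalSpace X] : Prop :=
  ∀ T T' : IrreducibleCloseds X, T ≤ T' →
    (∃ n : ℕ, ∀ p : LTSeries (IrreducibleCloseds X),
      p.head = T → p.last = T' → p.length ≤ n) ∧
    (∃ p : LTSeries (IrreducibleCloseds X), IsMaximalChainFromTo T T' p) ∧
    ∀ p q : LTSeries (IrreducibleCloseds X),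
      IsMaximalChainFromTo T T' p → IsMaximalChainFromTo T T' q → p.length = q.length

/-- A scheme `S` is universally catenary if every scheme locally of finite type over `S` is
catenary. -/
def IsUniversallyCatenary (S : Scheme.{u}) : Prop :=
  ∀ (X : Scheme.{u}) (f : X ⟶ S), LocallyOfFiniteType f → IsCatenarySpace X

/-- The specialisation `x ⤳ y` is immediate: `x ≠ y` and no third point lies between them. -/
def IsImmediateSpecialization {X : Type u} [TopologicalSpace X] (x y : X) : Prop :=
  x ⤳ y ∧ x ≠ y ∧ ∀ z : X, x ⤳ z → z ⤳ y → z = x ∨ z = y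

/-- A dimension function on a topological space. -/
structure IsDimensionFunction {X : Type u} [TopologicalSpace X] (δ : X → ℤ) : Prop where
  lt_of_specializes : ∀ x y : X, x ⤳ y → x ≠ y → δ y < δ x
  immediate_iff : ∀ x y : X, x ⤳ y → (IsImmediateSpecialization x y ↔ δ x = δ y + 1)

/-- The closure of a point, as an irreducible closed subset. -/
def pointClosure {X : Type u} [TopologicalSpace X] (x : X) : IrreducibleCloseds X :=
  ⟨closure {x}, isIrreducible_singleton.closure, isClosed_closure⟩

/-- The codimension of an irreducible closed subset `T` of `X`: the supremum of the lengths of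
the chains `T = T₀ ⊂ T₁ ⊂ ⋯ ⊂ Tₙ` of irreducible closed subsets of `X`. -/
noncomputable def codimension {X : Type u} [TopologicalSpace X] (T : IrreducibleCloseds X) : ℕ∞ :=
  Order.coheight T

/-- The transcendence degree of `κ(x)` over `κ(f(x))`, along the map of residue fields
induced by `f`. -/
noncomputable def residueTrdeg {X S : Scheme.{u}} (f : X ⟶ S) (x : X) : Cardinal.{u} :=
  letI := (f.residueFieldMap x).hom.toAlgebra
  Algebra.trdeg (S.residueField (f x)) (X.residueField x)

/-- `δ(x) = tr.deg_{κ(f(x))} κ(x) - codim (closure of {f(x)})`. -/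
noncomputable def deltaFunction {X S : Scheme.{u}} (f : X ⟶ S) (x : X) : ℤ :=
  (Cardinal.toNat (residueTrdeg f x) : ℤ) - ((codimension (pointClosure (f x))).toNat : ℤ)

/-- The multiplicative set of those sections over the affine open `U` that lie in none of the
prime ideals of `Γ(X, U)` corresponding to the points of `s`. -/
noncomputable def semilocalSubmonoid {X : Scheme.{u}} {U : X.Opens} (hU : IsAffineOpen U)
    (s : Set U) : Submonoid Γ(X, U) :=
  ⨅ x ∈ s, (hU.primeIdealOf x).asIdeal.primeCompl

/-- The semilocalisation of `X` at a set `s` of points of an affine open `U` of `X`: the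
localisation of `Γ(X, U)` away from the union of the primes corresponding to the points of `s`. -/
abbrev Semilocalisation {X : Scheme.{u}} {U : X.Opens} (hU : IsAffineOpen U)
    (s : Set U) : Type u :=
  Localization (semilocalSubmonoid hU s)

/-! An integer function that strictly drops under specialisation, and by exactly one along immediate
specialisations, is a dimension function. A sober space carrying one is catenary, since lengths of
maximal chains are differences of `δ`, and has finite Krull dimension if `δ` is bounded. The
conditions on `δ` are local, so take `X = Spec B` with `B` of finite type over `R`, and primes `Q <
P` of `B`.

The Prüfer condition enters only through `LocallyTotalDvd`, with three consequences. Primes below a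
given prime form a chain, so height grows by one along a covering pair in `Spec R`. Algebraic
independence modulo `P` persists modulo `Q` (`algebraicIndependent_quotient_of_le`), which bounds
the transcendence degree at `Q` from below. A weak going down (`exists_isPrime_between`) makes the
contractions of an immediate pair equal or adjacent.

The upper bound for immediate pairs comes from Zariski's main theorem. Lift a transcendence basis of
`B ⧸ P` to a family `b` in `B`, adding an element of `P` outside `Q` if the contractions to `R`
agree. Over `A = R[b]` the quotient `B ⧸ P` is algebraic and the contractions of `Q` and `P` differ.
Then `P` is isolated in its fibre in `Spec (B ⧸ Q)` over `A`, which forces `B ⧸ Q` to be algebraic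
over `A` (`Algebra.IsAlgebraic.quotient_of_immediate`). -/

/-- Any two elements of `R` divide one another in some direction, locally at each prime. -/
def LocallyTotalDvd (R : Type*) [CommRing R] : Prop :=
  ∀ (p : Ideal R) [p.IsPrime] (a b : R), ∃ s ∉ p, a ∣ s * b ∨ b ∣ s * a

/-- Clear denominators in the divisibility that holds in the valuation ring at `p`. -/
theorem IsPruferDomain.locallyTotalDvd {R : Type u} [CommRing R] (hR : IsPruferDomain R) :
    LocallyTotalDvd R := by
  have key : ∀ (p : Ideal R) [p.IsPrime] (a b : R) (z : Localization.AtPrime p),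
      algebraMap R (Localization.AtPrime p) a * z = algebraMap R _ b → ∃ s ∉ p, a ∣ s * b := by
    intro p _ a b z hz
    obtain ⟨r, s, rfl⟩ := IsLocalization.exists_mk'_eq p.primeCompl z
    rw [← IsLocalization.mk'_one (M := p.primeCompl) _ a, ← IsLocalization.mk'_mul,
      IsLocalization.mk'_eq_iff_eq_mul, ← map_mul,
      IsLocalization.eq_iff_exists p.primeCompl] at hz
    obtain ⟨t, ht⟩ := hz
    refine ⟨t * s, (t * s).2, t * r, ?_⟩
    simp only [one_mul] at ht
    linear_combination -ht
  intro p _ a b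
  obtain ⟨_, hv⟩ := hR.valuationRing_localization p
  obtain ⟨z, hz | hz⟩ := ValuationRing.cond (algebraMap R (Localization.AtPrime p) a)
    (algebraMap R (Localization.AtPrime p) b)
  · obtain ⟨s, hs, h⟩ := key p a b z hz
    exact ⟨s, hs, .inl h⟩
  · obtain ⟨s, hs, h⟩ := key p b a z hz
    exact ⟨s, hs, .inr h⟩

/-! ### Chains of primes and a weak going down -/

namespace LocallyTotalDvd

variable {R : Type*} [CommRing R] (hR : LocallyTotalDvd R)
include hR

/-- The primes below a given prime form a chain. -/
theorem le_or_le {p q r : Ideal R} [p.IsPrime] [q.IsPrime] [r.IsPrime] (hq : q ≤ p)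
    (hr : r ≤ p) : q ≤ r ∨ r ≤ q := by
  by_contra! h
  obtain ⟨a, haq, har⟩ := SetLike.not_le_iff_exists.mp h.1
  obtain ⟨b, hbr, hbq⟩ := SetLike.not_le_iff_exists.mp h.2
  obtain ⟨s, hs, hd | hd⟩ := hR p a b
  · exact (Ideal.IsPrime.mem_or_mem ‹_› (q.mem_of_dvd hd haq)).elim (fun h ↦ hs (hq h)) hbq
  · exact (Ideal.IsPrime.mem_or_mem ‹_› (r.mem_of_dvd hd hbr)).elim (fun h ↦ hs (hr h)) har

/-- Locally at a prime, one of finitely many elements divides all the others. -/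
theorem exists_dvd_forall (p : Ideal R) [p.IsPrime] {ι : Type*} (t : Finset ι) (ht : t.Nonempty)
    (c : ι → R) : ∃ i ∈ t, ∃ s ∉ p, ∀ j ∈ t, c i ∣ s * c j := by
  classical
  induction ht using Finset.Nonempty.cons_induction with
  | singleton a => exact ⟨a, by simp, 1, Ideal.one_notMem p, by simp⟩
  | cons a t ha ht ih =>
    obtain ⟨i, hi, s, hs, h⟩ := ih
    obtain ⟨u, hu, hd | hd⟩ := hR p (c i) (c a)
    · refine ⟨i, by simp [hi], u * s, Ideal.IsPrime.mul_notMem ‹_› hu hs, fun j hj ↦ ?_⟩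
      rw [Finset.mem_cons] at hj
      rcases hj with rfl | hj
      · rw [mul_right_comm]; exact hd.mul_right _
      · rw [mul_assoc]; exact (h j hj).mul_left _
    · refine ⟨a, by simp, u * s, Ideal.IsPrime.mul_notMem ‹_› hu hs, fun j hj ↦ ?_⟩
      rw [Finset.mem_cons] at hj
      rcases hj with rfl | hj
      · exact Dvd.intro_left _ rfl
      · rw [mul_assoc]; exact hd.trans (mul_dvd_mul_left u (h j hj))

variable {B : Type*} [CommRing B] [Algebra R B]

/-- A consequence of going down: if there is a prime strictly between the contractions of
`Q ≤ P`, then there is one strictly between `Q` and `P`. -/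
theorem exists_isPrime_between {Q P : Ideal B} [Q.IsPrime] [P.IsPrime] (hQP : Q ≤ P)
    {r : Ideal R} [r.IsPrime] (h₁ : Q.under R < r) (h₂ : r < P.under R) :
    ∃ P' : Ideal B, P'.IsPrime ∧ Q < P' ∧ P' < P := by
  obtain ⟨a, har, haq⟩ := SetLike.exists_of_lt h₁
  obtain ⟨x, hxp, hxr⟩ := SetLike.exists_of_lt h₂
  -- A prime containing `Q` and `a`, and avoiding all `x ^ n * s` with `s ∉ P`, lies in `P` and
  -- differs from `Q` (by `a`) and from `P` (by `x`). It need not lie over `r`.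
  have hdisj : Disjoint ((Q ⊔ Ideal.span {algebraMap R B a} : Ideal B) : Set B)
      ((Submonoid.powers (algebraMap R B x) ⊔ P.primeCompl : Submonoid B) : Set B) := by
    rw [Set.disjoint_left]
    intro z hz hz'
    obtain ⟨i, hi, w, hw, rfl⟩ := Submodule.mem_sup.mp hz
    obtain ⟨b, rfl⟩ := Ideal.mem_span_singleton'.mp hw
    obtain ⟨_, ⟨n, rfl⟩, s, hs, h⟩ := Submonoid.mem_sup.mp hz'
    have hxn : x ^ n ∉ r := fun h ↦ hxr (Ideal.IsPrime.mem_of_pow_mem ‹_› n h)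
    -- Since `a ∈ r` and `t, x ^ n ∉ r`, only `t * a = x ^ n * c` is possible, with `c ∈ r`.
    -- Multiplying the relation `h` by `t` and cancelling `x ^ n` modulo `Q` puts `t * s` in `P`.
    obtain ⟨t, ht, hd | ⟨c, hc⟩⟩ := hR (P.under R) a (x ^ n)
    · exact (Ideal.IsPrime.mem_or_mem ‹_› (r.mem_of_dvd hd har)).elim (fun h ↦ ht (h₂.le h)) hxn
    · have hcr : c ∈ r := (Ideal.IsPrime.mem_or_mem ‹r.IsPrime›
        (hc ▸ r.mul_mem_left t har)).resolve_left hxn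
      have hc' := congrArg (algebraMap R B) hc
      simp only [map_mul, map_pow] at hc' h
      have key : algebraMap R B x ^ n * (algebraMap R B t * s - algebraMap R B c * b) ∈ Q := by
        have : algebraMap R B x ^ n * (algebraMap R B t * s - algebraMap R B c * b) =
            algebraMap R B t * i := by
          linear_combination algebraMap R B t * h + b * hc'
        rw [this]
        exact Q.mul_mem_left _ hi
      have hxQ : algebraMap R B x ^ n ∉ Q := fun h ↦
        hxr (h₁.le (Ideal.IsPrime.mem_of_pow_mem ‹_› n h : algebraMap R B x ∈ Q))
      have h' := hQP ((Ideal.IsPrime.mem_or_mem ‹Q.IsPrime› key).resolve_left hxQ)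
      have hcb : algebraMap R B c * b ∈ P := P.mul_mem_right _ (h₂.le hcr)
      have hts : algebraMap R B t * s ∈ P := by simpa using P.add_mem h' hcb
      exact (Ideal.IsPrime.mem_or_mem ‹_› hts).elim ht hs
  obtain ⟨P', hP', hle, hd⟩ := Ideal.exists_le_prime_disjoint _ _ hdisj
  have haP' : algebraMap R B a ∈ P' :=
    hle (Ideal.mem_sup_right (Ideal.mem_span_singleton_self _))
  have hxP' : algebraMap R B x ∉ P' := fun h ↦ Set.disjoint_left.mp hd h
    (Submonoid.mem_sup_left (Submonoid.mem_powers _) : _ ∈ _ ⊔ P.primeCompl)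
  refine ⟨P', hP', lt_of_le_of_ne (le_sup_left.trans hle) ?_, lt_of_le_of_ne ?_ ?_⟩
  · rintro rfl; exact haq haP'
  · intro y hy
    by_contra hyP
    exact Set.disjoint_left.mp hd hy
      (Submonoid.mem_sup_right (S := Submonoid.powers (algebraMap R B x)) hyP)
  · rintro rfl; exact hxP' hxp

end LocallyTotalDvd

/-! ### Lifting algebraic independence from `B ⧸ P` to `B ⧸ Q` -/

section AlgebraicIndependent

variable {R : Type*} [CommRing R] {B : Type*} [CommRing B] [Algebra R B]

open MvPolynomial

theorem aeval_quotient_map (P : Ideal B) {ι : Type*} (b : ι → B) (F : MvPolynomial ι R) :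
    aeval (Ideal.Quotient.mk P ∘ b) (map (Ideal.Quotient.mk (P.under R)) F) =
      Ideal.Quotient.mk P (aeval b F) := by
  induction F using MvPolynomial.induction_on with
  | C a => simp
  | add p q hp hq => simp [hp, hq]
  | mul_X p i hp => simp [hp]

theorem algebraicIndependent_quotient_iff {P : Ideal B} {ι : Type*} {b : ι → B} :
    AlgebraicIndependent (R ⧸ P.under R) (Ideal.Quotient.mk P ∘ b) ↔
      ∀ F : MvPolynomial ι R, aeval b F ∈ P → ∀ m, coeff m F ∈ P.under R := by
  rw [algebraicIndependent_iff,
    (map_surjective _ (Ideal.Quotient.mk_surjective (I := P.under R))).forall]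
  simp only [aeval_quotient_map, Ideal.Quotient.eq_zero_iff_mem, MvPolynomial.ext_iff, coeff_map, coeff_zero]

/-- Divide a relation by its content. Some coefficient `c` of `F`, outside `Q`, divides all the
others up to a factor `s ∉ P`, so `s F = c G`, and the corresponding coefficient of `G` is congruent
to `s` modulo `Q`. Cancelling `c` gives `G(b) ∈ Q ≤ P`, and independence modulo `P` then forces `s ∈
P`. -/
theorem LocallyTotalDvd.algebraicIndependent_quotient_of_le (hR : LocallyTotalDvd R)
    {Q P : Ideal B} [Q.IsPrime] [P.IsPrime] (hQP : Q ≤ P) {ι : Type*} {b : ι → B}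
    (hb : AlgebraicIndependent (R ⧸ P.under R) (Ideal.Quotient.mk P ∘ b)) :
    AlgebraicIndependent (R ⧸ Q.under R) (Ideal.Quotient.mk Q ∘ b) := by
  rw [algebraicIndependent_quotient_iff] at hb ⊢
  intro F hF
  by_contra! hne
  obtain ⟨m₀, hm₀⟩ := hne
  have hm₀' : m₀ ∈ F.support := mem_support_iff.mpr fun h ↦ hm₀ (h ▸ zero_mem _)
  obtain ⟨i, hi, s, hs, hd⟩ := hR.exists_dvd_forall (P.under R) F.support ⟨m₀, hm₀'⟩ (coeff · F)
  have hsQ : s ∉ Q.under R := fun h ↦ hs (hQP h)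
  have hi' : coeff i F ∉ Q.under R := fun h ↦
    (Ideal.IsPrime.mem_or_mem inferInstance ((Q.under R).mem_of_dvd (hd m₀ hm₀') h)).elim hsQ hm₀
  have hCd : C (coeff i F) ∣ C s * F := by
    rw [C_dvd_iff_dvd_coeff]
    intro m
    rw [coeff_C_mul]
    by_cases hm : m ∈ F.support
    · exact hd m hm
    · simp [notMem_support_iff.mp hm]
  obtain ⟨G, hG⟩ := hCd
  have hGP : aeval b G ∈ P := by
    have := congrArg (aeval b) hG
    simp only [map_mul, algHom_C] at this
    have h2 := Q.mul_mem_left (algebraMap R B s) hF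
    rw [this] at h2
    exact hQP ((Ideal.IsPrime.mem_or_mem ‹_› h2).resolve_left hi')
  have hGi := hb G hGP i
  have hc := congrArg (coeff i) hG
  simp only [coeff_C_mul] at hc
  have : coeff i F * (s - coeff i G) ∈ Q.under R := by
    have : coeff i F * (s - coeff i G) = 0 := by linear_combination hc
    rw [this]; exact zero_mem _
  have h3 := (Ideal.IsPrime.mem_or_mem (inferInstance : (Q.under R).IsPrime) this).resolve_left hi'
  have h4 : s - coeff i G ∈ P.under R := hQP h3
  exact hs (by simpa using add_mem h4 hGi)

/-- If `f` were algebraic over `R[b]` modulo `Q`, it would divide some nonzero `G(b)` there. As `f ∈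
P`, this gives `G(b) ∈ P`, so the coefficients of `G` lie in the contraction of `P`, which is that
of `Q`, a contradiction. -/
theorem algebraicIndependent_quotient_option {Q P : Ideal B} [Q.IsPrime] [P.IsPrime]
    (hQP : Q ≤ P) (hu : Q.under R = P.under R) {f : B} (hfP : f ∈ P) (hfQ : f ∉ Q)
    {ι : Type*} {b : ι → B}
    (hb : AlgebraicIndependent (R ⧸ P.under R) (Ideal.Quotient.mk P ∘ b)) :
    AlgebraicIndependent (R ⧸ Q.under R)
      (Ideal.Quotient.mk Q ∘ fun o : Option ι ↦ o.elim f b) := by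
  rw [algebraicIndependent_quotient_iff] at hb
  have hbQ : AlgebraicIndependent (R ⧸ Q.under R) (Ideal.Quotient.mk Q ∘ b) :=
    algebraicIndependent_quotient_iff.mpr fun F hF ↦ hu ▸ hb F (hQP hF)
  have : (Ideal.Quotient.mk Q ∘ fun o : Option ι ↦ o.elim f b) =
      fun o : Option ι ↦ o.elim (Ideal.Quotient.mk Q f) (Ideal.Quotient.mk Q ∘ b) := by
    ext (_ | _) <;> rfl
  rw [this, hbQ.option_iff_transcendental]
  intro halg
  have hf0 : Ideal.Quotient.mk Q f ∈ nonZeroDivisors (B ⧸ Q) :=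
    mem_nonZeroDivisors_of_ne_zero fun h ↦ hfQ (Ideal.Quotient.eq_zero_iff_mem.mp h)
  obtain ⟨⟨r, hr⟩, hr0, z, hz⟩ := halg.exists_nonzero_dvd hf0
  obtain ⟨z, rfl⟩ := Ideal.Quotient.mk_surjective z
  rw [Algebra.adjoin_range_eq_range_aeval] at hr
  obtain ⟨g, rfl⟩ := hr
  apply hr0
  obtain ⟨G, rfl⟩ := map_surjective _ (Ideal.Quotient.mk_surjective (I := Q.under R)) g
  change aeval (Ideal.Quotient.mk Q ∘ b) (map (Ideal.Quotient.mk (Q.under R)) G) = _ at hz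
  rw [aeval_quotient_map, ← map_mul, Ideal.Quotient.mk_eq_mk_iff_sub_mem] at hz
  have hGP : aeval b G ∈ P := by
    simpa using P.add_mem (hQP hz) (P.mul_mem_right z hfP)
  have h0 : map (Ideal.Quotient.mk (Q.under R)) G = 0 := by
    ext m
    rw [coeff_map, coeff_zero, Ideal.Quotient.eq_zero_iff_mem, hu]
    exact hb G hGP m
  ext
  simp [h0]

end AlgebraicIndependent

/-! ### Isolated points of fibres and Zariski's main theorem -/

section QuasiFinite

variable {A B : Type*} [CommRing A] [CommRing B] [Algebra A B]

/-- A prime that is incomparable to the other primes of its fibre is isolated in the fibre. -/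
theorem Algebra.QuasiFiniteAt.of_forall_eq_of_under_eq [Algebra.FiniteType A B]
    (P : Ideal B) [P.IsPrime]
    (hP : ∀ P' : Ideal B, P'.IsPrime → P'.under A = P.under A → P' ≤ P ∨ P ≤ P' → P' = P) :
    Algebra.QuasiFiniteAt A P := by
  let q : PrimeSpectrum B := ⟨P, ‹_›⟩
  refine Algebra.QuasiFiniteAt.of_isOpen_singleton_fiber q ?_
  let p := q.comap (algebraMap A B)
  let e := PrimeSpectrum.preimageHomeomorphFiber A B p
  let o := PrimeSpectrum.preimageOrderIsoFiber A B p
  rw [← e.isOpen_image, Set.image_singleton]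
  have : Algebra.FiniteType p.asIdeal.ResidueField (p.asIdeal.Fiber B) := inferInstance
  have : IsNoetherianRing (p.asIdeal.Fiber B) :=
    Algebra.FiniteType.isNoetherianRing p.asIdeal.ResidueField _
  have : IsJacobsonRing (p.asIdeal.Fiber B) :=
    isJacobsonRing_of_finiteType (A := p.asIdeal.ResidueField)
  -- In a Noetherian Jacobson spectrum, a point is open as soon as it is closed and stable under
  -- generalisation.
  rw [(PrimeSpectrum.isOpen_singleton_tfae_of_isNoetherian_of_isJacobsonRing _).out 0 2 rfl rfl]
  have key : ∀ z, z ≤ e ⟨q, rfl⟩ ∨ e ⟨q, rfl⟩ ≤ z → z = e ⟨q, rfl⟩ := by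
    intro z hz
    obtain ⟨⟨y, hy⟩, rfl⟩ := o.surjective z
    have hz' : (⟨y, hy⟩ : (PrimeSpectrum.comap (algebraMap A B) ⁻¹' {p})) ≤ ⟨q, rfl⟩ ∨
      (⟨q, rfl⟩ : (PrimeSpectrum.comap (algebraMap A B) ⁻¹' {p})) ≤ ⟨y, hy⟩ :=
      hz.imp o.le_iff_le.mp o.le_iff_le.mp
    have : y = q := PrimeSpectrum.ext
      (hP y.asIdeal y.isPrime (congrArg PrimeSpectrum.asIdeal hy) hz')
    subst this
    rfl
  constructor
  · rw [PrimeSpectrum.isClosed_singleton_iff_isMaximal, ← PrimeSpectrum.isMax_iff]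
    intro z hz
    exact (key z (.inr hz)).le
  · intro x y hxy hx
    rw [Set.mem_singleton_iff] at hx ⊢
    subst hx
    exact key y (.inl ((PrimeSpectrum.le_iff_specializes _ _).mpr hxy))

/-- By algebraicity, an element of `P'` outside `P` divides, modulo `P`, a nonzero element coming
from `A`. That element lies in the contraction of `P'` but not in that of `P`. -/
theorem Ideal.under_ne_of_lt_of_isAlgebraic {P P' : Ideal B} [P.IsPrime]
    [Algebra.IsAlgebraic (A ⧸ P.under A) (B ⧸ P)] (h : P < P') : P'.under A ≠ P.under A := by
  obtain ⟨y, hyP', hyP⟩ := SetLike.exists_of_lt h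
  have hy : Ideal.Quotient.mk P y ∈ nonZeroDivisors (B ⧸ P) :=
    mem_nonZeroDivisors_of_ne_zero fun h ↦ hyP (Ideal.Quotient.eq_zero_iff_mem.mp h)
  obtain ⟨r, hr, z, hz⟩ := (Algebra.IsAlgebraic.isAlgebraic (R := A ⧸ P.under A)
    (Ideal.Quotient.mk P y)).exists_nonzero_dvd hy
  obtain ⟨z, rfl⟩ := Ideal.Quotient.mk_surjective z
  obtain ⟨r, rfl⟩ := Ideal.Quotient.mk_surjective r
  intro heq
  apply hr
  rw [Ideal.Quotient.eq_zero_iff_mem, ← heq]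
  change Ideal.Quotient.mk P (algebraMap A B r) = _ at hz
  rw [← map_mul, Ideal.Quotient.mk_eq_mk_iff_sub_mem] at hz
  have := P'.add_mem (h.le hz) (P'.mul_mem_right z hyP')
  simpa using this

/-- If `Q < P` are primes with nothing in between and different contractions, and `B ⧸ P` is
algebraic over `A`, then so is `B ⧸ Q`. -/
theorem Algebra.IsAlgebraic.quotient_of_immediate [Algebra.FiniteType A B] {Q P : Ideal B}
    [Q.IsPrime] [P.IsPrime] (hQP : Q ≤ P)
    (hmin : ∀ P' : Ideal B, P'.IsPrime → Q ≤ P' → P' ≤ P → P' = Q ∨ P' = P)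
    (hne : Q.under A ≠ P.under A) [Algebra.IsAlgebraic (A ⧸ P.under A) (B ⧸ P)] :
    Algebra.IsAlgebraic (A ⧸ Q.under A) (B ⧸ Q) := by
  let π := Ideal.Quotient.mk Q
  have hπ : Function.Surjective π := Ideal.Quotient.mk_surjective
  have hker : RingHom.ker π ≤ P := by rwa [Ideal.mk_ker]
  let P₁ := P.map π
  have : P₁.IsPrime := Ideal.map_isPrime_of_surjective hπ hker
  have hcomap : P₁.comap π = P := by
    rw [Ideal.comap_map_of_surjective' _ hπ, sup_eq_left.mpr hker]
  have hunder : ∀ I : Ideal (B ⧸ Q), I.under A = (I.comap π).under A := fun I ↦ rfl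
  have hQle : ∀ I : Ideal (B ⧸ Q), Q ≤ I.comap π := fun I x hx ↦ by
    rw [Ideal.mem_comap, Ideal.Quotient.eq_zero_iff_mem.mpr hx]; exact I.zero_mem
  -- Strictly below `P₁` there is only the zero ideal, which has another contraction by `hne`.
  -- Primes strictly above are excluded from the fibre because `B ⧸ P` is algebraic.
  have : Algebra.QuasiFiniteAt A P₁ := by
    refine .of_forall_eq_of_under_eq P₁ fun P' hP' hu hle ↦ ?_
    apply Ideal.comap_injective_of_surjective _ hπ
    rw [hunder, hunder, hcomap] at hu
    rw [hcomap]
    rcases hle with hle | hle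
    · refine (hmin _ inferInstance (hQle _) (hcomap ▸ Ideal.comap_mono hle)).resolve_left
        fun h ↦ hne (h ▸ hu)
    · by_contra hc
      exact Ideal.under_ne_of_lt_of_isAlgebraic
        (lt_of_le_of_ne (hcomap ▸ Ideal.comap_mono hle : P ≤ P'.comap π) (Ne.symm hc)) hu
  -- Zariski's main theorem gives `r ∉ P₁` integral over `A` such that every `x` becomes integral
  -- after multiplication by a power of `r`. In the domain `B ⧸ Q` this makes every `x` algebraic.
  obtain ⟨r, hr, hrint, h⟩ := Algebra.zariskisMainProperty_iff.mp
    (Algebra.ZariskisMainProperty.of_finiteType (R := A) P₁)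
  have hr0 : r ≠ 0 := fun h ↦ hr (h ▸ P₁.zero_mem)
  refine ⟨fun x ↦ ?_⟩
  obtain ⟨m, hm⟩ := h x
  have h1 : IsAlgebraic (A ⧸ Q.under A) (r ^ m * x) := hm.tower_top.isAlgebraic
  have h2 : IsAlgebraic (A ⧸ Q.under A) (r ^ m) := (hrint.pow m).tower_top.isAlgebraic
  exact h2.of_mul (mem_nonZeroDivisors_of_ne_zero (pow_ne_zero m hr0)) h1

end QuasiFinite

/-! ### Change of base from `R` to `R[b]` -/

section Adjoin

variable {R B : Type*} [CommRing R] [CommRing B] [Algebra R B]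

/-- Both base rings have the same image in `B ⧸ P` and inject into it. -/
theorem isAlgebraic_quotient_adjoin_iff (P : Ideal B) {ι : Type*} (b : ι → B) :
    Algebra.IsAlgebraic (Algebra.adjoin R (Set.range b) ⧸
        P.under (Algebra.adjoin R (Set.range b))) (B ⧸ P) ↔
      Algebra.IsAlgebraic (Algebra.adjoin (R ⧸ P.under R)
        (Set.range (Ideal.Quotient.mk P ∘ b))) (B ⧸ P) := by
  let A := Algebra.adjoin R (Set.range b)
  let A' := Algebra.adjoin (R ⧸ P.under R) (Set.range (Ideal.Quotient.mk P ∘ b))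
  have hmem : ∀ a : A ⧸ P.under A, algebraMap (A ⧸ P.under A) (B ⧸ P) a ∈ A' := by
    intro a
    obtain ⟨⟨a, ha⟩, rfl⟩ := Ideal.Quotient.mk_surjective a
    change Ideal.Quotient.mk P a ∈ A'
    induction ha using Algebra.adjoin_induction with
    | mem x hx => obtain ⟨i, rfl⟩ := hx; exact Algebra.subset_adjoin ⟨i, rfl⟩
    | algebraMap r => exact A'.algebraMap_mem (Ideal.Quotient.mk _ r)
    | add x y _ _ hx hy => rw [map_add]; exact add_mem hx hy
    | mul x y _ _ hx hy => rw [map_mul]; exact mul_mem hx hy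
  let f : (A ⧸ P.under A) →+* A' := (algebraMap (A ⧸ P.under A) (B ⧸ P)).codRestrict A' hmem
  have hinj : Function.Injective f := fun x y h ↦
    FaithfulSMul.algebraMap_injective (A ⧸ P.under A) (B ⧸ P) (congrArg Subtype.val h)
  have hsurj : Function.Surjective f := by
    rintro ⟨y, hy⟩
    suffices ∃ x : A, Ideal.Quotient.mk P x = y by
      obtain ⟨x, rfl⟩ := this
      exact ⟨Ideal.Quotient.mk _ x, rfl⟩
    induction hy using Algebra.adjoin_induction with
    | mem x hx => obtain ⟨i, rfl⟩ := hx; exact ⟨⟨b i, Algebra.subset_adjoin ⟨i, rfl⟩⟩, rfl⟩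
    | algebraMap r =>
      obtain ⟨r, rfl⟩ := Ideal.Quotient.mk_surjective r
      exact ⟨algebraMap R A r, rfl⟩
    | add x y _ _ hx hy =>
      obtain ⟨x, rfl⟩ := hx
      obtain ⟨y, rfl⟩ := hy
      exact ⟨x + y, rfl⟩
    | mul x y _ _ hx hy =>
      obtain ⟨x, rfl⟩ := hx
      obtain ⟨y, rfl⟩ := hy
      exact ⟨x * y, rfl⟩
  exact (Algebra.isAlgebraic_ringHom_iff_of_comp_eq (RingEquiv.ofBijective f ⟨hinj, hsurj⟩)
    (RingEquiv.refl (B ⧸ P)) (by ext; rfl)).symm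

end Adjoin

/-! ### Transcendence degree along specialisations -/

section Trdeg

variable {R B : Type u} [CommRing R] [CommRing B] [Algebra R B]

/-- The transcendence degree of `B ⧸ P` over the image of `R`. -/
noncomputable def quotientTrdeg (R : Type u) {B : Type u} [CommRing R] [CommRing B]
    [Algebra R B] (P : Ideal B) : Cardinal.{u} :=
  Algebra.trdeg (R ⧸ P.under R) (B ⧸ P)

theorem quotientTrdeg_lt_aleph0 [Algebra.FiniteType R B] (P : Ideal B) [P.IsPrime] :
    quotientTrdeg R P < Cardinal.aleph0 := by
  have : Algebra.FiniteType (R ⧸ P.under R) (B ⧸ P) :=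
    .of_restrictScalars_finiteType R _ _
  exact trdeg_lt_aleph0_of_finiteType

/-- The number of generators of `B` over `R` is a bound uniform in `P`. -/
theorem exists_quotientTrdeg_le [Algebra.FiniteType R B] :
    ∃ n : ℕ, ∀ (P : Ideal B) [P.IsPrime], quotientTrdeg R P ≤ n := by
  obtain ⟨n, f, hf⟩ := Algebra.FiniteType.iff_quotient_mvPolynomial''.mp ‹Algebra.FiniteType R B›
  refine ⟨n, fun P _ ↦ ?_⟩
  let g : MvPolynomial (Fin n) (R ⧸ P.under R) →ₐ[R ⧸ P.under R] (B ⧸ P) :=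
    MvPolynomial.aeval fun i ↦ Ideal.Quotient.mk P (f (MvPolynomial.X i))
  have hg : Function.Surjective g := by
    intro y
    obtain ⟨y, rfl⟩ := Ideal.Quotient.mk_surjective y
    obtain ⟨F, rfl⟩ := hf y
    refine ⟨MvPolynomial.map (Ideal.Quotient.mk (P.under R)) F, ?_⟩
    induction F using MvPolynomial.induction_on with
    | C a =>
      rw [MvPolynomial.algHom_C]
      simp [g]
    | add p q hp hq => simp only [map_add, hp, hq]
    | mul_X p i hp => simp only [map_mul, hp, MvPolynomial.map_X]; simp [g]
  have := lift_trdeg_le_of_surjective g hg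
  simpa [quotientTrdeg] using this

theorem exists_isTranscendenceBasis_quotient (P : Ideal B) [P.IsPrime] :
    ∃ (ι : Type u) (b : ι → B), IsTranscendenceBasis (R ⧸ P.under R) (Ideal.Quotient.mk P ∘ b) := by
  obtain ⟨ι, x, hx⟩ := exists_isTranscendenceBasis' (R ⧸ P.under R) (B ⧸ P)
  choose b hb using fun i ↦ Ideal.Quotient.mk_surjective (x i)
  exact ⟨ι, b, by rwa [show Ideal.Quotient.mk P ∘ b = x from funext hb]⟩

theorem LocallyTotalDvd.quotientTrdeg_le (hR : LocallyTotalDvd R) {Q P : Ideal B} [Q.IsPrime]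
    [P.IsPrime] (hQP : Q ≤ P) : quotientTrdeg R P ≤ quotientTrdeg R Q := by
  obtain ⟨ι, b, hb⟩ := exists_isTranscendenceBasis_quotient (R := R) P
  have := (hR.algebraicIndependent_quotient_of_le hQP hb.1).cardinalMk_le_trdeg
  rwa [hb.cardinalMk_eq_trdeg] at this

theorem quotientTrdeg_add_one_le {Q P : Ideal B} [Q.IsPrime] [P.IsPrime] (hQP : Q < P)
    (hu : Q.under R = P.under R) : quotientTrdeg R P + 1 ≤ quotientTrdeg R Q := by
  obtain ⟨f, hfP, hfQ⟩ := SetLike.exists_of_lt hQP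
  obtain ⟨ι, b, hb⟩ := exists_isTranscendenceBasis_quotient (R := R) P
  have := (algebraicIndependent_quotient_option hQP.le hu hfP hfQ hb.1).cardinalMk_le_trdeg
  rwa [Cardinal.mk_option, hb.cardinalMk_eq_trdeg] at this

variable [Algebra.FiniteType R B] {Q P : Ideal B} [Q.IsPrime] [P.IsPrime]

/-- Apply `Algebra.IsAlgebraic.quotient_of_immediate` with base `R[b]`; the element in `hne`
separates the contractions of `Q` and `P` to it. -/
theorem isTranscendenceBasis_quotient_of_immediate (hQP : Q ≤ P)
    (hmin : ∀ P' : Ideal B, P'.IsPrime → Q ≤ P' → P' ≤ P → P' = Q ∨ P' = P)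
    {ι : Type u} {b : ι → B}
    (hQ : AlgebraicIndependent (R ⧸ Q.under R) (Ideal.Quotient.mk Q ∘ b))
    (hP : Algebra.IsAlgebraic (Algebra.adjoin (R ⧸ P.under R)
        (Set.range (Ideal.Quotient.mk P ∘ b))) (B ⧸ P))
    (hne : ∃ a ∈ Algebra.adjoin R (Set.range b), a ∈ P ∧ a ∉ Q) :
    IsTranscendenceBasis (R ⧸ Q.under R) (Ideal.Quotient.mk Q ∘ b) := by
  rw [hQ.isTranscendenceBasis_iff_isAlgebraic, ← isAlgebraic_quotient_adjoin_iff]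
  rw [← isAlgebraic_quotient_adjoin_iff] at hP
  have : Algebra.FiniteType (Algebra.adjoin R (Set.range b)) B :=
    .of_restrictScalars_finiteType R _ _
  refine Algebra.IsAlgebraic.quotient_of_immediate hQP hmin fun h ↦ ?_
  obtain ⟨a, ha, haP, haQ⟩ := hne
  have : (⟨a, ha⟩ : Algebra.adjoin R (Set.range b)) ∈ Q.under _ := by rw [h]; exact haP
  exact haQ this

theorem LocallyTotalDvd.quotientTrdeg_eq_of_immediate (hR : LocallyTotalDvd R) (hQP : Q ≤ P)
    (hmin : ∀ P' : Ideal B, P'.IsPrime → Q ≤ P' → P' ≤ P → P' = Q ∨ P' = P)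
    (hu : Q.under R < P.under R) : quotientTrdeg R Q = quotientTrdeg R P := by
  obtain ⟨ι, b, hb⟩ := exists_isTranscendenceBasis_quotient (R := R) P
  obtain ⟨a, haP, haQ⟩ := SetLike.exists_of_lt hu
  have := isTranscendenceBasis_quotient_of_immediate hQP hmin
    (hR.algebraicIndependent_quotient_of_le hQP hb.1) hb.isAlgebraic
    ⟨algebraMap R B a, Subalgebra.algebraMap_mem _ _, haP, haQ⟩
  exact this.cardinalMk_eq_trdeg.symm.trans hb.cardinalMk_eq_trdeg

theorem quotientTrdeg_eq_add_one_of_immediate (hQP : Q < P)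
    (hmin : ∀ P' : Ideal B, P'.IsPrime → Q ≤ P' → P' ≤ P → P' = Q ∨ P' = P)
    (hu : Q.under R = P.under R) : quotientTrdeg R Q = quotientTrdeg R P + 1 := by
  obtain ⟨f, hfP, hfQ⟩ := SetLike.exists_of_lt hQP
  obtain ⟨ι, b, hb⟩ := exists_isTranscendenceBasis_quotient (R := R) P
  -- Modulo `P` the enlarged family is no longer independent, as `f` maps to zero, but algebraicity
  -- over it is all that is required.
  have halg : Algebra.IsAlgebraic (Algebra.adjoin (R ⧸ P.under R)
      (Set.range (Ideal.Quotient.mk P ∘ fun o : Option ι ↦ o.elim f b))) (B ⧸ P) := by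
    have := hb.isAlgebraic
    have hle : Algebra.adjoin (R ⧸ P.under R) (Set.range (Ideal.Quotient.mk P ∘ b)) ≤
        Algebra.adjoin (R ⧸ P.under R)
          (Set.range (Ideal.Quotient.mk P ∘ fun o : Option ι ↦ o.elim f b)) := by
      apply Algebra.adjoin_mono
      rintro _ ⟨i, rfl⟩
      exact ⟨some i, rfl⟩
    exact ⟨fun x ↦ (this.isAlgebraic x).tower_top_of_subalgebra_le hle⟩
  have := isTranscendenceBasis_quotient_of_immediate hQP.le hmin
    (algebraicIndependent_quotient_option hQP.le hu hfP hfQ hb.1) halg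
    ⟨f, Algebra.subset_adjoin ⟨none, rfl⟩, hfP, hfQ⟩
  rw [quotientTrdeg, ← this.cardinalMk_eq_trdeg, Cardinal.mk_option, hb.cardinalMk_eq_trdeg]
  rfl

end Trdeg

/-! ### Chains in a partial order with a strictly monotone integer function -/

section Graded

variable {α : Type*} [PartialOrder α] {d : α → ℤ}

theorem LTSeries.length_le_sub (hd : StrictMono d) (p : LTSeries α) :
    (p.length : ℤ) ≤ d p.last - d p.head := by
  have : ∀ i : ℕ, ∀ hi : i < p.length + 1, (i : ℤ) ≤ d (p ⟨i, hi⟩) - d p.head := by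
    intro i
    induction i with
    | zero => intro hi; simp [RelSeries.head]
    | succ i ih =>
      intro hi
      have h1 := ih (by omega)
      have h2 : d (p ⟨i, by omega⟩) < d (p ⟨i + 1, hi⟩) :=
        hd (p.strictMono (by simp [Fin.lt_def]))
      push_cast
      omega
  exact this p.length (by omega)

theorem LTSeries.length_eq_sub (hc : ∀ a b : α, a ⋖ b → d b = d a + 1) (p : LTSeries α)
    (hp : ∀ i : Fin p.length, p i.castSucc ⋖ p i.succ) :
    (p.length : ℤ) = d p.last - d p.head := by
  have : ∀ i : ℕ, ∀ hi : i < p.length + 1, (i : ℤ) = d (p ⟨i, hi⟩) - d p.head := by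
    intro i
    induction i with
    | zero => intro hi; simp [RelSeries.head]
    | succ i ih =>
      intro hi
      have h1 := ih (by omega)
      have h2 : d (p ⟨i + 1, hi⟩) = d (p ⟨i, by omega⟩) + 1 := hc _ _ (hp ⟨i, by omega⟩)
      push_cast
      omega
  exact this p.length (by omega)

/-- Replacing `b` by an intermediate element lowers `d b - d a`, which stays positive, so the
process ends. -/
theorem StrictMono.exists_covBy_le (hd : StrictMono d) {a b : α} (hab : a < b) :
    ∃ c, a ⋖ c ∧ c ≤ b := by
  induction hn : (d b - d a).toNat using Nat.strong_induction_on generalizing b with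
  | _ n ih =>
    by_cases hcov : a ⋖ b
    · exact ⟨b, hcov, le_rfl⟩
    · obtain ⟨c, hac, hcb⟩ := (not_covBy_iff hab).mp hcov
      have h1 := hd hac
      have h2 := hd hcb
      obtain ⟨e, he, hec⟩ := ih (d c - d a).toNat (by omega) hac rfl
      exact ⟨e, he, hec.trans hcb.le⟩

theorem StrictMono.exists_ltSeries_covBy (hd : StrictMono d) {a b : α} (hab : a ≤ b) :
    ∃ p : LTSeries α, p.head = a ∧ p.last = b ∧
      ∀ i : Fin p.length, p i.castSucc ⋖ p i.succ := by
  induction hn : (d b - d a).toNat using Nat.strong_induction_on generalizing a with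
  | _ n ih =>
    rcases hab.eq_or_lt with rfl | hlt
    · exact ⟨RelSeries.singleton _ a, rfl, rfl, fun i ↦ i.elim0⟩
    · obtain ⟨c, hac, hcb⟩ := hd.exists_covBy_le hlt
      have h1 := hd hac.lt
      have h2 := hd.monotone hcb
      obtain ⟨p, hph, hpl, hp⟩ := ih (d b - d c).toNat (by omega) hcb rfl
      have key : ∀ i : Fin (p.length + 1), (Fin.cons a p.toFun : Fin (p.length + 2) → α) i.castSucc ⋖
          (Fin.cons a p.toFun : Fin (p.length + 2) → α) i.succ := by
        intro i
        induction i using Fin.cases with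
        | zero => rw [← hph] at hac; exact hac
        | succ i => exact hp i
      exact ⟨⟨p.length + 1, Fin.cons a p.toFun, fun i ↦ (key i).lt⟩, rfl, hpl, key⟩

end Graded

/-! ### Topological consequences of a dimension function -/

section DimensionFunction

variable {X : Type u} [TopologicalSpace X] {δ : X → ℤ}

/-- The converse half of `immediate_iff` is automatic: an intermediate point would force an integer
drop of at least two. -/
theorem IsDimensionFunction.of_immediate
    (hlt : ∀ x y : X, x ⤳ y → x ≠ y → δ y < δ x)
    (himm : ∀ x y : X, IsImmediateSpecialization x y → δ x = δ y + 1) :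
    IsDimensionFunction δ where
  lt_of_specializes := hlt
  immediate_iff x y hxy := by
    refine ⟨himm x y, fun h ↦ ⟨hxy, ?_, fun z hxz hzy ↦ ?_⟩⟩
    · rintro rfl
      omega
    · by_contra! hne
      have h1 := hlt x z hxz hne.1.symm
      have h2 := hlt z y hzy hne.2
      omega

/-- Stability under generalisation puts every point between two points of the image in the image, so
immediate specialisations stay immediate. -/
theorem IsDimensionFunction.comp_isEmbedding (hδ : IsDimensionFunction δ) {Y : Type u}
    [TopologicalSpace Y] {f : Y → X} (hf : Topology.IsEmbedding f)
    (hgen : StableUnderGeneralization (Set.range f)) : IsDimensionFunction (δ ∘ f) := by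
  refine .of_immediate (fun x y hxy hne ↦ hδ.lt_of_specializes _ _
    (hxy.map hf.continuous) (hf.injective.ne hne)) fun x y ⟨hxy, hne, h⟩ ↦ ?_
  refine (hδ.immediate_iff _ _ (hxy.map hf.continuous)).mp
    ⟨hxy.map hf.continuous, hf.injective.ne hne, fun z hxz hzy ↦ ?_⟩
  obtain ⟨z, rfl⟩ := hgen hzy ⟨y, rfl⟩
  exact (h z (hf.isInducing.specializes_iff.mp hxz)
    (hf.isInducing.specializes_iff.mp hzy)).imp (congrArg f) (congrArg f)

variable [QuasiSober X]

theorem specializes_genericPoint_iff {S T : IrreducibleCloseds X} :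
    S.isIrreducible.genericPoint ⤳ T.isIrreducible.genericPoint ↔ T ≤ S := by
  have h : ∀ T : IrreducibleCloseds X, closure {T.isIrreducible.genericPoint} = (T : Set X) :=
    fun T ↦ (T.isIrreducible.isGenericPoint_genericPoint T.isClosed)
  rw [specializes_iff_closure_subset, h, h]
  rfl

theorem IsDimensionFunction.strictMono_genericPoint (hδ : IsDimensionFunction δ) :
    StrictMono fun T : IrreducibleCloseds X ↦ δ T.isIrreducible.genericPoint := by
  intro T S hTS
  refine hδ.lt_of_specializes _ _ (specializes_genericPoint_iff.mpr hTS.le) fun h ↦ ?_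
  exact hTS.not_ge (specializes_genericPoint_iff.mp (specializes_of_eq h.symm))

theorem IsDimensionFunction.topologicalKrullDim_lt_top (hδ : IsDimensionFunction δ) {a b : ℤ}
    (hab : ∀ x, a ≤ δ x ∧ δ x ≤ b) :
    topologicalKrullDim X < ⊤ := by
  have : topologicalKrullDim X ≤ ((b - a).toNat : ℕ∞) := by
    refine iSup_le fun p ↦ ?_
    have := LTSeries.length_le_sub hδ.strictMono_genericPoint p
    have h1 := hab p.last.isIrreducible.genericPoint
    have h2 := hab p.head.isIrreducible.genericPoint
    simp only at this
    have h3 : p.length ≤ (b - a).toNat := by omega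
    exact_mod_cast h3
  exact this.trans_lt (WithBot.coe_lt_coe.mpr (ENat.natCast_lt_top _))

variable [T0Space X]

theorem genericPoint_pointClosure (x : X) : (pointClosure x).isIrreducible.genericPoint = x :=
  ((pointClosure x).isIrreducible.isGenericPoint_genericPoint (pointClosure x).isClosed).eq
    isGenericPoint_closure

namespace IsDimensionFunction

variable (hδ : IsDimensionFunction δ)
include hδ

theorem genericPoint_eq_add_one_of_covBy {T S : IrreducibleCloseds X} (h : T ⋖ S) :
    δ S.isIrreducible.genericPoint = δ T.isIrreducible.genericPoint + 1 := by
  have hs := specializes_genericPoint_iff.mpr h.le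
  refine (hδ.immediate_iff _ _ hs).mp ⟨hs, fun he ↦ ?_, fun z h1 h2 ↦ ?_⟩
  · exact h.lt.not_ge (specializes_genericPoint_iff.mp (specializes_of_eq he.symm))
  · rw [← genericPoint_pointClosure z, specializes_genericPoint_iff] at h1 h2
    rcases h.eq_or_eq h2 h1 with h | h
    · exact .inr (by rw [← h, genericPoint_pointClosure])
    · exact .inl (by rw [← h, genericPoint_pointClosure])

theorem isCatenarySpace : IsCatenarySpace X := by
  intro T T' hTT'
  refine ⟨⟨(δ T'.isIrreducible.genericPoint - δ T.isIrreducible.genericPoint).toNat, ?_⟩,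
    hδ.strictMono_genericPoint.exists_ltSeries_covBy hTT', ?_⟩
  · rintro p rfl rfl
    have := LTSeries.length_le_sub hδ.strictMono_genericPoint p
    simp only at this
    omega
  · rintro p q ⟨hp, hp', hpc⟩ ⟨hq, hq', hqc⟩
    have h1 := LTSeries.length_eq_sub
      (fun _ _ ↦ hδ.genericPoint_eq_add_one_of_covBy) p hpc
    have h2 := LTSeries.length_eq_sub
      (fun _ _ ↦ hδ.genericPoint_eq_add_one_of_covBy) q hqc
    rw [hp, hp'] at h1
    rw [hq, hq'] at h2
    omega

end IsDimensionFunction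

end DimensionFunction

/-! ### The function `δ` on an affine scheme -/

section AffineDelta

variable {R B : Type u} [CommRing R] [CommRing B] [Algebra R B]

/-- The function `δ` on the spectrum of an `R`-algebra. -/
noncomputable def affineDelta (R : Type u) {B : Type u} [CommRing R] [CommRing B] [Algebra R B]
    (P : PrimeSpectrum B) : ℤ :=
  (Cardinal.toNat (quotientTrdeg R P.asIdeal) : ℤ) -
    ((Order.height (PrimeSpectrum.comap (algebraMap R B) P)).toNat : ℤ)

theorem PrimeSpectrum.height_lt_top (hdim : ringKrullDim R < ⊤) (p : PrimeSpectrum R) :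
    Order.height p < ⊤ :=
  WithBot.coe_lt_coe.mp ((Order.height_le_krullDim p).trans_lt hdim)

/-- Primes below `p` form a chain, so every prime strictly below `p` is at most `q`. -/
theorem LocallyTotalDvd.height_eq_add_one (hR : LocallyTotalDvd R) {q p : PrimeSpectrum R}
    (h : q ⋖ p) : Order.height p = Order.height q + 1 := by
  refine le_antisymm ?_ (Order.height_add_one_le h.lt)
  rw [Order.height_eq_iSup_lt_height]
  refine iSup₂_le fun r hr ↦ ?_
  gcongr
  rcases hR.le_or_le (p := p.asIdeal) (q := r.asIdeal) (r := q.asIdeal) hr.le h.le with hle | hle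
  · exact hle
  · rcases h.eq_or_eq hle hr.le with rfl | rfl
    · exact le_rfl
    · exact absurd hr (lt_irrefl _)

/-- If the contractions to `R` agree, only the transcendence degree changes. If they differ, the
height supplies the drop while the transcendence degree does not increase from `x` to `y`, and is
constant when the pair is immediate. -/
theorem LocallyTotalDvd.isDimensionFunction_affineDelta (hR : LocallyTotalDvd R)
    (hdim : ringKrullDim R < ⊤) [Algebra.FiniteType R B] :
    IsDimensionFunction (affineDelta R : PrimeSpectrum B → ℤ) := by
  have hlt : ∀ {x y : PrimeSpectrum B}, x ⤳ y → x ≠ y → x < y := fun h hne ↦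
    lt_of_le_of_ne ((PrimeSpectrum.le_iff_specializes _ _).mpr h) hne
  refine .of_immediate (fun x y hxy hne ↦ ?_) fun x y ⟨hxy, hne, himm⟩ ↦ ?_
  · replace hxy := hlt hxy hne
    have hfin := quotientTrdeg_lt_aleph0 (R := R) x.asIdeal
    have hu : PrimeSpectrum.comap (algebraMap R B) x ≤ PrimeSpectrum.comap (algebraMap R B) y :=
      Ideal.comap_mono hxy.le
    have hy := PrimeSpectrum.height_lt_top hdim (PrimeSpectrum.comap (algebraMap R B) y)
    rcases hu.eq_or_lt with hu | hu
    · have h1 := Cardinal.toNat_le_toNat (quotientTrdeg_add_one_le (R := R)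
        (show x.asIdeal < y.asIdeal from hxy) (congrArg PrimeSpectrum.asIdeal hu)) hfin
      rw [Cardinal.toNat_add (quotientTrdeg_lt_aleph0 _) Cardinal.one_lt_aleph0,
        Cardinal.one_toNat] at h1
      simp only [affineDelta, hu]
      omega
    · have h1 := Cardinal.toNat_le_toNat (hR.quotientTrdeg_le
        (show x.asIdeal ≤ y.asIdeal from hxy.le)) hfin
      have h2 := ENat.toNat_le_toNat (Order.height_add_one_le hu) hy.ne
      rw [ENat.toNat_add (PrimeSpectrum.height_lt_top hdim _).ne ENat.one_ne_top,
        ENat.toNat_one] at h2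
      simp only [affineDelta]
      omega
  · replace hxy := hlt hxy hne
    have hmin : ∀ P' : Ideal B, P'.IsPrime → x.asIdeal ≤ P' → P' ≤ y.asIdeal →
        P' = x.asIdeal ∨ P' = y.asIdeal := fun P' _ h1 h2 ↦
      (himm ⟨P', ‹_›⟩ ((PrimeSpectrum.le_iff_specializes _ _).mp h1)
        ((PrimeSpectrum.le_iff_specializes _ _).mp h2)).imp
          (congrArg PrimeSpectrum.asIdeal) (congrArg PrimeSpectrum.asIdeal)
    have hu : PrimeSpectrum.comap (algebraMap R B) x ≤ PrimeSpectrum.comap (algebraMap R B) y :=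
      Ideal.comap_mono hxy.le
    rcases hu.eq_or_lt with hu | hu
    · have h1 := quotientTrdeg_eq_add_one_of_immediate (R := R)
        (show x.asIdeal < y.asIdeal from hxy) hmin (congrArg PrimeSpectrum.asIdeal hu)
      simp only [affineDelta, hu, h1]
      rw [Cardinal.toNat_add (quotientTrdeg_lt_aleph0 _) Cardinal.one_lt_aleph0,
        Cardinal.one_toNat]
      push_cast
      ring
    · have h1 := hR.quotientTrdeg_eq_of_immediate
        (show x.asIdeal ≤ y.asIdeal from hxy.le) hmin hu
      -- Weak going down: a prime strictly between the contractions would yield one strictly between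
      -- `x` and `y`.
      have hcov : PrimeSpectrum.comap (algebraMap R B) x ⋖
          PrimeSpectrum.comap (algebraMap R B) y := by
        refine ⟨hu, fun r hr hr' ↦ ?_⟩
        obtain ⟨P', hP', h1, h2⟩ := hR.exists_isPrime_between (r := r.asIdeal)
          (show x.asIdeal ≤ y.asIdeal from hxy.le) hr hr'
        rcases hmin P' hP' h1.le h2.le with h | h
        · exact h1.ne h.symm
        · exact h2.ne h
      simp only [affineDelta, h1, hR.height_eq_add_one hcov]
      rw [ENat.toNat_add (PrimeSpectrum.height_lt_top hdim _).ne ENat.one_ne_top]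
      simp
      ring

theorem exists_affineDelta_bounds (hdim : ringKrullDim R < ⊤) [Algebra.FiniteType R B] :
    ∃ a b : ℤ, ∀ P : PrimeSpectrum B, a ≤ affineDelta R P ∧ affineDelta R P ≤ b := by
  obtain ⟨n, hn⟩ := exists_quotientTrdeg_le (R := R) (B := B)
  obtain ⟨m, hm⟩ : ∃ m : ℕ, ringKrullDim R < m := by
    rcases h : ringKrullDim R with _ | _ | m
    · exact ⟨0, WithBot.bot_lt_coe _⟩
    · exact absurd hdim (h ▸ lt_irrefl _)
    · refine ⟨m + 1, ?_⟩
      exact WithBot.coe_lt_coe.mpr (ENat.natCast_lt_natCast.mpr (Nat.lt_succ_self m))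
  refine ⟨-m, n, fun P ↦ ?_⟩
  have h1 := Cardinal.toNat_le_toNat (hn P.asIdeal) (Cardinal.natCast_lt_aleph0)
  have h2 : Order.height (PrimeSpectrum.comap (algebraMap R B) P) < (m : ℕ∞) :=
    WithBot.coe_lt_coe.mp ((Order.height_le_krullDim _).trans_lt hm)
  have h3 := ENat.toNat_le_toNat h2.le (ENat.natCast_ne_top m)
  simp only [Cardinal.toNat_natCast, ENat.toNat_natCast] at h1 h3
  simp only [affineDelta]
  omega

/-- Taking closures of points reverses the order on primes, which turns coheight into height. -/
theorem codimension_pointClosure_eq_height (p : PrimeSpectrum R) :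
    codimension (pointClosure p) = Order.height p :=
  Order.height_orderIso (PrimeSpectrum.pointsEquivIrreducibleCloseds R) p

end AffineDelta

/-! ### Residue fields of schemes versus quotients by primes -/

section ResidueField

/-- The transcendence degree of the target of a ring homomorphism over its source. -/
noncomputable def RingHom.trdeg {K L : Type u} [CommRing K] [CommRing L] (φ : K →+* L) :
    Cardinal.{u} :=
  letI := φ.toAlgebra
  Algebra.trdeg K L

theorem RingHom.trdeg_comp_ringEquiv {K L L' : Type u} [CommRing K] [CommRing L] [CommRing L']
    (φ : K →+* L) (e : L ≃+* L') : (e.toRingHom.comp φ).trdeg = φ.trdeg := by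
  let := φ.toAlgebra
  let := (e.toRingHom.comp φ).toAlgebra
  exact ((AlgEquiv.ofRingEquiv (f := e) fun _ ↦ rfl : L ≃ₐ[K] L').trdeg_eq).symm

/-- Fraction fields are algebraic over their domains, so additivity in the towers `D, C, L` and `D,
K, L` computes the same number. The isomorphisms `e₁`, `e₂` accommodate residue fields of schemes,
which are only isomorphic to those of prime ideals. -/
theorem RingHom.trdeg_eq_of_isFractionRing {D C K' L' K L : Type u} [CommRing D] [IsDomain D]
    [CommRing C] [IsDomain C] [Algebra D C] [FaithfulSMul D C] [Field K'] [Field L']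
    [Algebra D K'] [Algebra C L'] [IsFractionRing D K'] [IsFractionRing C L']
    [Field K] [Field L] (φ : K →+* L) (e₁ : K' ≃+* K) (e₂ : L' ≃+* L)
    (h : ∀ d, φ (e₁ (algebraMap D K' d)) = e₂ (algebraMap C L' (algebraMap D C d))) :
    φ.trdeg = Algebra.trdeg D C := by
  let : Algebra D K := (e₁.toRingHom.comp (algebraMap D K')).toAlgebra
  let : Algebra C L := (e₂.toRingHom.comp (algebraMap C L')).toAlgebra
  let : Algebra D L := ((algebraMap C L).comp (algebraMap D C)).toAlgebra
  let : Algebra K L := φ.toAlgebra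
  have : IsScalarTower D C L := .of_algebraMap_eq fun _ ↦ rfl
  have : IsScalarTower D K L := .of_algebraMap_eq fun d ↦ (h d).symm
  have : Algebra.IsAlgebraic D K' := IsLocalization.isAlgebraic K' (nonZeroDivisors D)
  have : Algebra.IsAlgebraic C L' := IsLocalization.isAlgebraic L' (nonZeroDivisors C)
  have : Algebra.IsAlgebraic D K :=
    (AlgEquiv.ofRingEquiv (f := e₁) fun _ ↦ rfl : K' ≃ₐ[D] K).isAlgebraic
  have : Algebra.IsAlgebraic C L :=
    (AlgEquiv.ofRingEquiv (f := e₂) fun _ ↦ rfl : L' ≃ₐ[C] L).isAlgebraic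
  have : FaithfulSMul D K := (faithfulSMul_iff_algebraMap_injective D K).mpr
    (e₁.injective.comp (IsFractionRing.injective D K'))
  have : FaithfulSMul C L := (faithfulSMul_iff_algebraMap_injective C L).mpr
    (e₂.injective.comp (IsFractionRing.injective C L'))
  have h1 := trdeg_add_eq D C (A := L)
  have h2 := trdeg_add_eq D K (A := L)
  rw [trdeg_eq_zero (R := C) (A := L), add_zero] at h1
  rw [trdeg_eq_zero (R := D) (A := K), zero_add] at h2
  exact h2.trans h1.symm

/-- The prime is kept separate from `y.asIdeal` so that, at an image point, it can be taken to be a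
contraction `z.asIdeal.under R`. -/
theorem exists_ringEquiv_residueField (R : CommRingCat.{u}) (y : Spec R) {p : Ideal R}
    [p.IsPrime] (hp : y.asIdeal = p) :
    ∃ e : p.ResidueField ≃+* (Spec R).residueField y, ∀ r : R,
      e (algebraMap R p.ResidueField r) =
        ((Spec R).Γevaluation y).hom ((Scheme.ΓSpecIso R).inv.hom r) := by
  subst hp
  exact ⟨(Scheme.Spec.residueFieldIso R y).symm.commRingCatIsoToRingEquiv, fun r ↦
    congrArg (fun g : R ⟶ (Spec R).residueField y ↦ g.hom r)
      (Scheme.Spec.algebraMap_residueFieldIso_inv R y)⟩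

theorem residueTrdeg_specMap {R B : CommRingCat.{u}} (ψ : R ⟶ B) (z : Spec B) :
    letI := ψ.hom.toAlgebra
    residueTrdeg (Spec.map ψ) z = quotientTrdeg R z.asIdeal := by
  let := ψ.hom.toAlgebra
  have : z.asIdeal.IsPrime := z.isPrime
  obtain ⟨e₁, h₁⟩ := exists_ringEquiv_residueField R (Spec.map ψ z)
    (p := z.asIdeal.under R) rfl
  obtain ⟨e₂, h₂⟩ := exists_ringEquiv_residueField B z (p := z.asIdeal) rfl
  refine RingHom.trdeg_eq_of_isFractionRing (D := R ⧸ z.asIdeal.under R) (C := B ⧸ z.asIdeal)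
    ((Spec.map ψ).residueFieldMap z).hom e₁ e₂ fun d ↦ ?_
  obtain ⟨d, rfl⟩ := Ideal.Quotient.mk_surjective d
  refine (congrArg ((Spec.map ψ).residueFieldMap z).hom (h₁ d)).trans
    (Eq.trans ?_ (h₂ (ψ.hom d)).symm)
  refine (Scheme.Γevaluation_naturality_apply (Spec.map ψ) z _).trans ?_
  exact congrArg ((Spec B).Γevaluation z).hom
    (congrArg (fun g ↦ g.hom d) (Scheme.ΓSpecIso_inv_naturality ψ)).symm

theorem residueTrdeg_comp_of_isOpenImmersion {X S Y : Scheme.{u}} (g : Y ⟶ X)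
    [IsOpenImmersion g] (f : X ⟶ S) (y : Y) : residueTrdeg (g ≫ f) y = residueTrdeg f (g y) := by
  have h : (g ≫ f).residueFieldMap y = f.residueFieldMap (g y) ≫ g.residueFieldMap y :=
    Scheme.residueFieldMap_comp ..
  change ((g ≫ f).residueFieldMap y).hom.trdeg = (f.residueFieldMap (g y)).hom.trdeg
  rw [h]
  exact RingHom.trdeg_comp_ringEquiv _ (asIso (g.residueFieldMap y)).commRingCatIsoToRingEquiv

end ResidueField

/-! ### Globalisation to schemes over `Spec R` -/

section Scheme

variable {R : Type u} [CommRing R] {X : Scheme.{u}} (f : X ⟶ Spec (CommRingCat.of R))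

/-- The ring homomorphism underlying the restriction of `f` to an affine open. -/
noncomputable def affineRestriction {U : X.Opens} (hU : IsAffineOpen U) :
    CommRingCat.of R ⟶ Γ(X, U) :=
  Spec.preimage (hU.fromSpec ≫ f)

theorem specMap_affineRestriction {U : X.Opens} (hU : IsAffineOpen U) :
    Spec.map (affineRestriction f hU) = hU.fromSpec ≫ f :=
  Spec.map_preimage _

theorem finiteType_affineRestriction [LocallyOfFiniteType f] {U : X.Opens}
    (hU : IsAffineOpen U) : (affineRestriction f hU).hom.FiniteType := by
  rw [← HasRingHomProperty.Spec_iff (P := @LocallyOfFiniteType), specMap_affineRestriction]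
  infer_instance

theorem residueTrdeg_fromSpec {U : X.Opens} (hU : IsAffineOpen U) (z : Spec Γ(X, U)) :
    letI := (affineRestriction f hU).hom.toAlgebra
    residueTrdeg f (hU.fromSpec z) = quotientTrdeg R z.asIdeal := by
  rw [← residueTrdeg_comp_of_isOpenImmersion, ← specMap_affineRestriction]
  exact residueTrdeg_specMap _ z

theorem deltaFunction_fromSpec {U : X.Opens} (hU : IsAffineOpen U) (z : Spec Γ(X, U)) :
    letI := (affineRestriction f hU).hom.toAlgebra
    deltaFunction f (hU.fromSpec z) = affineDelta R z := by
  have h : f (hU.fromSpec z) = Spec.map (affineRestriction f hU) z := by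
    rw [specMap_affineRestriction]; rfl
  rw [deltaFunction, residueTrdeg_fromSpec, h]
  let := (affineRestriction f hU).hom.toAlgebra
  have h2 := codimension_pointClosure_eq_height (R := R)
    (PrimeSpectrum.comap (algebraMap R Γ(X, U)) z)
  exact congrArg (fun n : ℕ∞ ↦ (Cardinal.toNat (quotientTrdeg R z.asIdeal) : ℤ) - (n.toNat : ℤ)) h2

theorem exists_fromSpec_eq {U : X.Opens} (hU : IsAffineOpen U) {x : X} (hx : x ∈ U) :
    ∃ z, hU.fromSpec z = x :=
  hU.range_fromSpec.ge hx

theorem exists_isAffineOpen_mem (x : X) : ∃ U : X.Opens, IsAffineOpen U ∧ x ∈ U := by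
  obtain ⟨U, hU, hx, -⟩ := exists_isAffineOpen_mem_and_subset (U := ⊤)
    (TopologicalSpace.Opens.mem_top x)
  exact ⟨U, hU, hx⟩

variable [LocallyOfFiniteType f]

theorem residueTrdeg_lt_aleph0 (x : X) : residueTrdeg f x < Cardinal.aleph0 := by
  obtain ⟨U, hU, hx⟩ := exists_isAffineOpen_mem x
  obtain ⟨z, rfl⟩ := exists_fromSpec_eq hU hx
  let := (affineRestriction f hU).hom.toAlgebra
  have : Algebra.FiniteType R Γ(X, U) := finiteType_affineRestriction f hU
  have : z.asIdeal.IsPrime := z.isPrime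
  rw [residueTrdeg_fromSpec]
  exact quotientTrdeg_lt_aleph0 _

theorem LocallyTotalDvd.isDimensionFunction_deltaFunction (hR : LocallyTotalDvd R)
    (hdim : ringKrullDim R < ⊤) : IsDimensionFunction (deltaFunction f) := by
  have haff : ∀ {U : X.Opens} (hU : IsAffineOpen U),
      IsDimensionFunction (X := Spec Γ(X, U)) (deltaFunction f ∘ hU.fromSpec) := by
    intro U hU
    let := (affineRestriction f hU).hom.toAlgebra
    have : Algebra.FiniteType R Γ(X, U) := finiteType_affineRestriction f hU
    rw [show deltaFunction f ∘ hU.fromSpec = affineDelta R from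
      funext fun z ↦ deltaFunction_fromSpec f hU z]
    exact hR.isDimensionFunction_affineDelta hdim
  -- An affine open neighbourhood of `y` contains every generalisation of `y`, hence `x`.
  have hlift : ∀ {x y : X}, x ⤳ y → ∃ (U : X.Opens) (hU : IsAffineOpen U) (z w : Spec Γ(X, U)),
      hU.fromSpec z = x ∧ hU.fromSpec w = y := by
    intro x y hxy
    obtain ⟨U, hU, hy⟩ := exists_isAffineOpen_mem y
    obtain ⟨w, hw⟩ := exists_fromSpec_eq hU hy
    obtain ⟨z, hz⟩ := exists_fromSpec_eq hU (hxy.mem_open U.isOpen hy)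
    exact ⟨U, hU, z, w, hz, hw⟩
  have hspec : ∀ {U : X.Opens} (hU : IsAffineOpen U) {z w : Spec Γ(X, U)},
      hU.fromSpec z ⤳ hU.fromSpec w ↔ z ⤳ w := fun hU ↦
    hU.fromSpec.isOpenEmbedding.isInducing.specializes_iff
  refine .of_immediate (fun x y hxy hne ↦ ?_) fun x y ⟨hxy, hne, himm⟩ ↦ ?_
  · obtain ⟨U, hU, z, w, rfl, rfl⟩ := hlift hxy
    exact (haff hU).lt_of_specializes z w ((hspec hU).mp hxy) fun h ↦ hne (congrArg _ h)
  · obtain ⟨U, hU, z, w, rfl, rfl⟩ := hlift hxy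
    refine ((haff hU).immediate_iff z w ((hspec hU).mp hxy)).mp
      ⟨(hspec hU).mp hxy, fun h ↦ hne (congrArg _ h), fun v h1 h2 ↦ ?_⟩
    have hinj := hU.fromSpec.isOpenEmbedding.injective
    exact (himm _ ((hspec hU).mpr h1) ((hspec hU).mpr h2)).imp (fun h ↦ hinj h) (fun h ↦ hinj h)

/-- Bounds exist on each affine open, and `X` is compact because `Spec R` is. -/
theorem exists_deltaFunction_bounds [QuasiCompact f] (hdim : ringKrullDim R < ⊤) :
    ∃ a b : ℤ, ∀ x : X, a ≤ deltaFunction f x ∧ deltaFunction f x ≤ b := by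
  have : CompactSpace X := QuasiCompact.compactSpace_of_compactSpace f
  have hloc : ∀ x : X, ∃ t ∈ nhds x, ∃ a b : ℤ, ∀ y ∈ t,
      a ≤ deltaFunction f y ∧ deltaFunction f y ≤ b := by
    intro x
    obtain ⟨U, hU, hx⟩ := exists_isAffineOpen_mem x
    let := (affineRestriction f hU).hom.toAlgebra
    have : Algebra.FiniteType R Γ(X, U) := finiteType_affineRestriction f hU
    obtain ⟨a, b, hab⟩ := exists_affineDelta_bounds (R := R) (B := Γ(X, U)) hdim
    refine ⟨U, U.isOpen.mem_nhds hx, a, b, fun y hy ↦ ?_⟩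
    obtain ⟨z, rfl⟩ := exists_fromSpec_eq hU hy
    rw [deltaFunction_fromSpec]
    exact hab z
  have := isCompact_univ.induction_on (X := X)
    (p := fun t ↦ ∃ a b : ℤ, ∀ y ∈ t, a ≤ deltaFunction f y ∧ deltaFunction f y ≤ b)
    ⟨0, 0, by simp⟩ (fun s t hst ⟨a, b, h⟩ ↦ ⟨a, b, fun y hy ↦ h y (hst hy)⟩)
    (fun s t ⟨a, b, h⟩ ⟨a', b', h'⟩ ↦ ⟨min a a', max b b', fun y hy ↦ ?_⟩)
    (fun x _ ↦ by simpa using hloc x)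
  · obtain ⟨a, b, h⟩ := this
    exact ⟨a, b, fun x ↦ h x trivial⟩
  · rcases hy with hy | hy
    · have := h y hy
      omega
    · have := h' y hy
      omega

end Scheme

theorem PrimeSpectrum.stableUnderGeneralization_range_comap_localization {B : Type u} [CommRing B]
    (M : Submonoid B) : StableUnderGeneralization
      (Set.range (PrimeSpectrum.comap (algebraMap B (Localization M)))) := by
  rw [PrimeSpectrum.localization_comap_range (Localization M) M]
  intro x y hxy hx
  exact Set.disjoint_of_subset_right ((PrimeSpectrum.le_iff_specializes _ _).mpr hxy) hx

/-- The spectrum of a localisation embeds in that of `Γ(X, U)`, and then in `X`, each time with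
image stable under generalisation, so `δ` restricts to a dimension function. -/
theorem IsDimensionFunction.comp_semilocalisation {X : Scheme.{u}} {δ : X → ℤ}
    (hδ : IsDimensionFunction δ) {U : X.Opens} (hU : IsAffineOpen U) (s : Set U) :
    IsDimensionFunction (δ ∘ hU.fromSpec ∘
      PrimeSpectrum.comap (algebraMap Γ(X, U) (Semilocalisation hU s))) :=
  have h1 : IsDimensionFunction (X := PrimeSpectrum Γ(X, U)) (δ ∘ hU.fromSpec) :=
    hδ.comp_isEmbedding hU.fromSpec.isOpenEmbedding.isEmbedding
      hU.fromSpec.isOpenEmbedding.isOpen_range.stableUnderGeneralization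
  h1.comp_isEmbedding (PrimeSpectrum.localization_comap_isEmbedding _ (semilocalSubmonoid hU s))
    (PrimeSpectrum.stableUnderGeneralization_range_comap_localization _)

theorem proposition2p4 {R : Type u} [CommRing R] (hR : IsPruferDomain R)
    (hdim : ringKrullDim R < ⊤) :
    (∀ (X : Scheme.{u}) (f : X ⟶ Spec (CommRingCat.of R)),
      LocallyOfFiniteType f → QuasiCompact f →
        -- the two terms of `δ` are finite, so `δ` is well defined
        (∀ x : X, residueTrdeg f x < Cardinal.aleph0 ∧ codimension (pointClosure (f x)) < ⊤) ∧
        IsDimensionFunction (deltaFunction f) ∧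
        (∃ a b : ℤ, ∀ x : X, a ≤ deltaFunction f x ∧ deltaFunction f x ≤ b) ∧
        (IsCatenarySpace X ∧ topologicalKrullDim X < ⊤) ∧
        ∀ (U : X.Opens) (hU : IsAffineOpen U) (s : Set U), s.Finite →
          IsCatenarySpace (PrimeSpectrum (Semilocalisation hU s)) ∧
          topologicalKrullDim (PrimeSpectrum (Semilocalisation hU s)) < ⊤) ∧
    IsUniversallyCatenary (Spec (CommRingCat.of R)) := by
  have hT := hR.locallyTotalDvd
  refine ⟨fun X f _ _ ↦ ?_, fun X f _ ↦
    (hT.isDimensionFunction_deltaFunction f hdim).isCatenarySpace⟩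
  have hδ := hT.isDimensionFunction_deltaFunction f hdim
  obtain ⟨a, b, hab⟩ := exists_deltaFunction_bounds f hdim
  refine ⟨fun x ↦ ⟨residueTrdeg_lt_aleph0 f x, ?_⟩, hδ, ⟨a, b, hab⟩,
    ⟨hδ.isCatenarySpace, hδ.topologicalKrullDim_lt_top hab⟩, fun U hU s _ ↦ ?_⟩
  · exact (codimension_pointClosure_eq_height (R := R) (f x)).trans_lt
      (PrimeSpectrum.height_lt_top hdim _)
  · exact ⟨(hδ.comp_semilocalisation hU s).isCatenarySpace,
      (hδ.comp_semilocalisation hU s).topologicalKrullDim_lt_top fun _ ↦ hab _⟩
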